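/- **Theorem 2 (Goal-oriented criterion).** Let $\mathcal M$ be a real separable Hilbert space, let $\mathcal F:\mathcal M\to\mathbb R^d$ be bounded and linear, let $\sigma>0$, and let $\mu_{\rm pr}=\mathcal N(m_{\rm pr},\mathcal C_{\rm pr})$ be a Gaussian measure on $\mathcal M$ with mean $m_{\rm pr}\in\mathcal M$ and strictly positive covariance operator $\mathcal C_{\rm pr}$. Consider the Bayesian inverse problem of inferring $m$ with prior $\mu_{\rm pr}$ from data $y=\mathcal Fm+\eta$, where $\eta\sim\mathcal N(0,\sigma^2 I)$ is independent of $m$, so that $y|m\sim\mathcal N(\mathcal Fm,\sigma^2I)$. Let $\mu_{\rm post}^{y}$ be its posterior, i.e. the conditional law of $m$ given $y$, and let $$\mathcal C_{\rm post}=(\sigma^{-2}\mathcal F^*\mathcal F+\mathcal C_{\rm pr}^{-1})^{-1}$$ be the posterior covariance operator. Let $\mathcal Z:\mathcal M\to\mathbb R$ be differentiable in a neighbourhood of $\bar m\in\mathcal M$ and twice differentiable at $\bar m$, put $\bar g=\nabla\mathcal Z(\bar m)$ and $\bar{\mathcal H}=\nabla^2\mathcal Z(\bar m)$, and let $$\mathcal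 Z_{\rm quad}(m)=\mathcal Z(\bar m)+\langle\bar g,m-\bar m\rangle+\tfrac12\langle\bar{\mathcal H}(m-\bar m),m-\bar m\rangle .$$ Define $$\Psi=\mathbb E_{m\sim\mu_{\rm pr}}\Big\{\mathbb E_{y|m}\big\{\mathbb V_{\mu_{\rm post}^{y}}\{\mathcal Z_{\rm quad}\}\big\}\Big\}.$$ Then the variances and both expectations in this definition exist and are finite (for almost all $m$ and $y$), the operators $\mathcal C_{\rm pr}\bar{\mathcal H}\,\mathcal C_{\rm post}\bar{\mathcal H}$ and $(\mathcal C_{\rm post}\bar{\mathcal H})^2$ are trace class, and $$\Psi=\|\bar{\mathcal H}(m_{\rm pr}-\bar m)+\bar g\|^2_{\mathcal C_{\rm post}}+\mathrm{tr}\big(\mathcal C_{\rm pr}\bar{\mathcal H}\,\mathcal C_{\rm post}\bar{\mathcal H}\big)-\tfrac12\,\mathrm{tr}\big((\mathcal C_{\rm post}\bar{\mathcal H})^2\big),$$ where $\|v\|^2_{\mathcal C_{\rm post}}=\langle\mathcal C_{\rm post}v,v\rangle$. -/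

import Mathlib

open MeasureTheory ProbabilityTheory Topology
open scoped RealInnerProductSpace Gradient InnerProduct

noncomputable section

/-! ### Trace class operators on a real Hilbert space -/

section TraceClass

variable {M : Type*} [NormedAddCommGroup M] [InnerProductSpace ℝ M]

/-- `T` is trace class (nuclear): `T x = ∑ₖ ⟪aₖ, x⟫ bₖ` for some sequences `a`, `b` in `M` with
`∑ₖ ‖aₖ‖ ‖bₖ‖ < ∞`. -/
def IsTraceClass (T : M →L[ℝ] M) : Prop :=
  ∃ a b : ℕ → M, Summable (fun k => ‖a k‖ * ‖b k‖) ∧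
    ∀ x : M, HasSum (fun k => ⟪a k, x⟫ • b k) (T x)

/-- The trace `∑ᵢ ⟪eᵢ, T eᵢ⟫`, computed in one complete orthonormal system of `M`. For trace class
operators it does not depend on that system, see `IsTraceClass.hasSum_trace`. -/
def operatorTrace [CompleteSpace M] (T : M →L[ℝ] M) : ℝ :=
  ∑' i, ⟪(exists_hilbertBasis ℝ M).choose_spec.choose i,
    T ((exists_hilbertBasis ℝ M).choose_spec.choose i)⟫

theorem hasSum_diagonal_of_nuclear {T : M →L[ℝ] M} {a b : ℕ → M}
    (hab : Summable (fun k => ‖a k‖ * ‖b k‖))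
    (hT : ∀ x : M, HasSum (fun k => ⟪a k, x⟫ • b k) (T x))
    {ι : Type*} (e : HilbertBasis ι ℝ M) :
    HasSum (fun i => ⟪e i, T (e i)⟫) (∑' k, ⟪a k, b k⟫) := by
  have hk : ∀ k, HasSum (fun i => ⟪a k, e i⟫ * ⟪e i, b k⟫) ⟪a k, b k⟫ := fun k =>
    e.hasSum_inner_mul_inner (a k) (b k)
  have hi : ∀ i, HasSum (fun k => ⟪a k, e i⟫ * ⟪e i, b k⟫) ⟪e i, T (e i)⟫ := fun i => by
    have := (hT (e i)).mapL (innerSL ℝ (e i))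
    simpa [inner_smul_right] using this
  have hbound : ∀ k (s : Finset ι),
      ∑ i ∈ s, ‖⟪a k, e i⟫ * ⟪e i, b k⟫‖ ≤ ‖a k‖ * ‖b k‖ := by
    intro k s
    have h1 := e.orthonormal.sum_inner_products_le (a k) (s := s)
    have h2 := e.orthonormal.sum_inner_products_le (b k) (s := s)
    have hcs := Finset.sum_mul_sq_le_sq_mul_sq s (fun i => ‖⟪e i, a k⟫‖) (fun i => ‖⟪e i, b k⟫‖)
    have heq : ∑ i ∈ s, ‖⟪a k, e i⟫ * ⟪e i, b k⟫‖ = ∑ i ∈ s, ‖⟪e i, a k⟫‖ * ‖⟪e i, b k⟫‖ :=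
      Finset.sum_congr rfl fun i _ => by rw [norm_mul, real_inner_comm]
    rw [heq]
    refine abs_le_of_sq_le_sq' ?_ (by positivity) |>.2
    rw [mul_pow]
    exact hcs.trans (mul_le_mul h1 h2 (Finset.sum_nonneg fun _ _ => sq_nonneg _) (sq_nonneg _))
  have hs : Summable (fun p : ℕ × ι => ⟪a p.1, e p.2⟫ * ⟪e p.2, b p.1⟫) := by
    refine Summable.of_norm ?_
    rw [summable_prod_of_nonneg (fun _ => norm_nonneg _)]
    have hsk : ∀ k, Summable (fun i => ‖⟪a k, e i⟫ * ⟪e i, b k⟫‖) := fun k =>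
      summable_of_sum_le (fun _ => norm_nonneg _) (hbound k)
    exact ⟨hsk, Summable.of_nonneg_of_le (fun k => tsum_nonneg fun _ => norm_nonneg _)
      (fun k => (hsk k).tsum_le_of_sum_le (hbound k)) hab⟩
  have hsum := hs.hasSum
  have h1 : ∑' p : ℕ × ι, ⟪a p.1, e p.2⟫ * ⟪e p.2, b p.1⟫ = ∑' k, ⟪a k, b k⟫ :=
    (hsum.prod_fiberwise hk).tsum_eq.symm
  have h2 := (hs.prod_symm.hasSum).prod_fiberwise (fun i => hi i)
  have h3 : ∑' p : ι × ℕ, ⟪a p.swap.1, e p.swap.2⟫ * ⟪e p.swap.2, b p.swap.1⟫ =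
      ∑' p : ℕ × ι, ⟪a p.1, e p.2⟫ * ⟪e p.2, b p.1⟫ :=
    (Equiv.prodComm ι ℕ).tsum_eq (fun p : ℕ × ι => ⟪a p.1, e p.2⟫ * ⟪e p.2, b p.1⟫)
  rw [h3, h1] at h2
  exact h2

/-- The trace of a trace class operator is computed by every complete orthonormal system. -/
theorem IsTraceClass.hasSum_trace [CompleteSpace M] {T : M →L[ℝ] M} (hT : IsTraceClass T)
    {ι : Type*} (e : HilbertBasis ι ℝ M) :
    HasSum (fun i => ⟪e i, T (e i)⟫) (operatorTrace T) := by
  obtain ⟨a, b, hab, h⟩ := hT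
  have h1 := hasSum_diagonal_of_nuclear hab h e
  have h2 := hasSum_diagonal_of_nuclear hab h (exists_hilbertBasis ℝ M).choose_spec.choose
  rw [operatorTrace, h2.tsum_eq]
  exact h1

end TraceClass

/-! ### Gaussian measures, the likelihood and the posterior covariance -/

section Inverse

variable {M : Type*} [NormedAddCommGroup M] [InnerProductSpace ℝ M]

/-- `μ = N(m₀, C)`: `μ` is a Gaussian measure on the Hilbert space `M` whose mean is `m₀` and whose
covariance operator is `C`. -/
structure IsGaussianWith [MeasurableSpace M] (μ : Measure M) (m₀ : M) (C : M →L[ℝ] M) : Prop where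
  isGaussian : IsGaussian μ
  mean : ∀ v : M, ⟪m₀, v⟫ = ∫ s, ⟪s, v⟫ ∂μ
  covariance : ∀ u v : M, ⟪C u, v⟫ = ∫ s, ⟪u, s - m₀⟫ * ⟪v, s - m₀⟫ ∂μ

theorem measurable_map_stdGaussian_add [MeasurableSpace M] [BorelSpace M] {d : ℕ}
    (F : M →L[ℝ] EuclideanSpace ℝ (Fin d))
    (L : EuclideanSpace ℝ (Fin d) →L[ℝ] EuclideanSpace ℝ (Fin d)) :
    Measurable fun m => (stdGaussian (EuclideanSpace ℝ (Fin d))).map (fun x => F m + L x) := by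
  have h : Measurable (fun p : M × EuclideanSpace ℝ (Fin d) => F p.1 + L p.2) := by
    fun_prop
  refine Measure.measurable_of_measurable_coe _ fun s hs => ?_
  have h2 := measurable_measure_prodMk_left (ν := stdGaussian (EuclideanSpace ℝ (Fin d))) (h hs)
  convert h2 using 2 with m
  rw [Measure.map_apply (by fun_prop) hs]
  rfl

/-- The data likelihood: given `m`, the data `y = F m + η` with `η ∼ N(0, σ² I)` has the law
`N(F m, σ² I)`. -/
def likelihood [MeasurableSpace M] [BorelSpace M] {d : ℕ}
    (F : M →L[ℝ] EuclideanSpace ℝ (Fin d)) (σ : ℝ) : Kernel M (EuclideanSpace ℝ (Fin d)) where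
  toFun m := multivariateGaussian (F m) (σ ^ 2 • (1 : Matrix (Fin d) (Fin d) ℝ))
  measurable' := measurable_map_stdGaussian_add F _

instance [MeasurableSpace M] [BorelSpace M] {d : ℕ}
    (F : M →L[ℝ] EuclideanSpace ℝ (Fin d)) (σ : ℝ) : IsMarkovKernel (likelihood F σ) :=
  ⟨fun m => inferInstanceAs (IsProbabilityMeasure
    (multivariateGaussian (F m) (σ ^ 2 • (1 : Matrix (Fin d) (Fin d) ℝ))))⟩

theorem mem_graph_toPMap_top (T : M →ₗ[ℝ] M) (x y : M) :
    (x, y) ∈ (T.toPMap ⊤).graph ↔ y = T x := by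
  rw [LinearPMap.mem_graph_iff]
  constructor
  · rintro ⟨z, rfl, rfl⟩
    rfl
  · rintro rfl
    exact ⟨⟨x, trivial⟩, rfl, rfl⟩

variable [CompleteSpace M] {d : ℕ}

/-- The Hessian `σ⁻² F* F` of the data misfit. -/
def misfitHessian (F : M →L[ℝ] EuclideanSpace ℝ (Fin d)) (σ : ℝ) : M →L[ℝ] M :=
  (σ ^ 2)⁻¹ • (F.adjoint ∘L F)

/-- The unbounded operator `σ⁻² F* F + C⁻¹`, with domain the range of `C`. -/
def posteriorPrecision (F : M →L[ℝ] EuclideanSpace ℝ (Fin d)) (σ : ℝ) (C : M →L[ℝ] M) :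
    M →ₗ.[ℝ] M :=
  (misfitHessian F σ : M →ₗ[ℝ] M).toPMap ⊤ + ((C : M →ₗ[ℝ] M).toPMap ⊤).inverse

open Classical in
/-- The posterior covariance operator `(σ⁻² F* F + C⁻¹)⁻¹`: the bounded operator on `M` that is the
inverse of the unbounded operator `σ⁻² F* F + C⁻¹`. It exists and is characterized by that when `C`
is strictly positive, see `posteriorCov_spec`. -/
def posteriorCov (F : M →L[ℝ] EuclideanSpace ℝ (Fin d)) (σ : ℝ) (C : M →L[ℝ] M) : M →L[ℝ] M :=
  if h : ∃ T : M →L[ℝ] M, (T : M →ₗ[ℝ] M).toPMap ⊤ = (posteriorPrecision F σ C).inverse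
  then h.choose else 0

theorem isUnit_one_add_misfitHessian_comp (F : M →L[ℝ] EuclideanSpace ℝ (Fin d)) (σ : ℝ)
    {C : M →L[ℝ] M} (hC : ∀ u : M, u ≠ 0 → 0 < ⟪C u, u⟫) :
    IsUnit (1 + misfitHessian F σ ∘L C) := by
  set A : EuclideanSpace ℝ (Fin d) →L[ℝ] M := F.adjoint with hA
  set B : M →L[ℝ] EuclideanSpace ℝ (Fin d) := (σ ^ 2)⁻¹ • (F ∘L C) with hB
  have hAB : misfitHessian F σ ∘L C = A ∘L B := by
    ext x
    simp [misfitHessian, hA, hB]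
  set G : EuclideanSpace ℝ (Fin d) →L[ℝ] EuclideanSpace ℝ (Fin d) := 1 + B ∘L A with hG
  have hGi : Function.Injective (G : EuclideanSpace ℝ (Fin d) →ₗ[ℝ] EuclideanSpace ℝ (Fin d)) := by
    rw [← LinearMap.ker_eq_bot, LinearMap.ker_eq_bot']
    intro v hv
    have hv' : v + (σ ^ 2)⁻¹ • F (C (A v)) = 0 := by simpa [hG, hB] using hv
    have h0 : ⟪v, v⟫ + (σ ^ 2)⁻¹ * ⟪C (A v), A v⟫ = 0 := by
      have := congrArg (fun w => ⟪w, v⟫) hv'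
      simp only [inner_add_left, real_inner_smul_left, inner_zero_left] at this
      rwa [hA, ContinuousLinearMap.adjoint_inner_right]
    have h1 : 0 ≤ ⟪C (A v), A v⟫ := by
      rcases eq_or_ne (A v) 0 with h | h
      · simp [h]
      · exact (hC _ h).le
    have h2 : ⟪v, v⟫ ≤ 0 := by
      have : 0 ≤ (σ ^ 2)⁻¹ * ⟪C (A v), A v⟫ := by positivity
      linarith
    rw [real_inner_self_eq_norm_sq] at h2
    exact norm_eq_zero.1 (pow_eq_zero_iff two_ne_zero |>.1 (le_antisymm h2 (sq_nonneg _)))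
  let Ge := (LinearEquiv.ofInjectiveEndo
    (G : EuclideanSpace ℝ (Fin d) →ₗ[ℝ] EuclideanSpace ℝ (Fin d)) hGi).toContinuousLinearEquiv
  let J : EuclideanSpace ℝ (Fin d) →L[ℝ] EuclideanSpace ℝ (Fin d) := Ge.symm
  have hGe : ∀ v, Ge v = G v := fun v => rfl
  have hGJ : ∀ v, J v + B (A (J v)) = v := fun v => by
    have : G (J v) = v := by rw [← hGe]; exact Ge.apply_symm_apply v
    simpa [hG] using this
  have hJG : ∀ v, J v + J (B (A v)) = v := fun v => by
    have : J (G v) = v := by rw [← hGe]; exact Ge.symm_apply_apply v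
    simpa [hG] using this
  rw [hAB]
  refine ⟨⟨1 + A ∘L B, 1 - A ∘L J ∘L B, ?_, ?_⟩, rfl⟩
  · ext x
    have h := congrArg A (hGJ (B x))
    rw [map_add] at h
    change (x - A (J (B x))) + A (B (x - A (J (B x)))) = x
    rw [map_sub, map_sub, ← h]
    abel
  · ext x
    have h := congrArg A (hJG (B x))
    rw [map_add] at h
    change (x + A (B x)) - A (J (B (x + A (B x)))) = x
    rw [map_add, map_add, map_add, h, add_sub_cancel_right]

/-- For strictly positive `C`, the inverse of `σ⁻² F* F + C⁻¹` is an everywhere defined bounded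
operator, namely `posteriorCov F σ C`. -/
theorem posteriorCov_spec (F : M →L[ℝ] EuclideanSpace ℝ (Fin d)) (σ : ℝ)
    {C : M →L[ℝ] M} (hC : ∀ u : M, u ≠ 0 → 0 < ⟪C u, u⟫) :
    LinearMap.ker (posteriorPrecision F σ C).toFun = ⊥ ∧
    (posteriorCov F σ C : M →ₗ[ℝ] M).toPMap ⊤ = (posteriorPrecision F σ C).inverse := by
  obtain ⟨S, hS⟩ := isUnit_one_add_misfitHessian_comp F σ hC
  have hS1 : ∀ w, (S : M →L[ℝ] M) w = w + misfitHessian F σ (C w) := fun w => by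
    rw [hS]; rfl
  have hSi : ∀ w, (S⁻¹ : (M →L[ℝ] M)ˣ).val ((S : M →L[ℝ] M) w) = w := fun w =>
    congrArg (fun T : M →L[ℝ] M => T w) S.inv_mul
  have hSi' : ∀ w, (S : M →L[ℝ] M) ((S⁻¹ : (M →L[ℝ] M)ˣ).val w) = w := fun w =>
    congrArg (fun T : M →L[ℝ] M => T w) S.mul_inv
  have hkC : LinearMap.ker ((C : M →ₗ[ℝ] M).toPMap ⊤).toFun = ⊥ := by
    rw [LinearMap.ker_eq_bot']
    intro u hu
    by_contra hne
    have h1 := hC u.1 (fun h => hne (Subtype.ext h))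
    have h2 : C u.1 = 0 := hu
    rw [h2, inner_zero_left] at h1
    exact lt_irrefl _ h1
  have hgC : ∀ x y, (x, y) ∈ (((C : M →ₗ[ℝ] M).toPMap ⊤).inverse).graph ↔ x = C y := by
    intro x y
    rw [LinearPMap.inverse_graph hkC, Submodule.mem_map]
    constructor
    · rintro ⟨⟨p, q⟩, hp, hpq⟩
      obtain ⟨rfl, rfl⟩ : q = x ∧ p = y := by simpa using hpq
      exact (mem_graph_toPMap_top _ _ _).1 hp
    · intro h
      exact ⟨(y, x), (mem_graph_toPMap_top _ _ _).2 h, rfl⟩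
  have hgP : ∀ x y, (x, y) ∈ (posteriorPrecision F σ C).graph ↔
      ∃ w, x = C w ∧ y = misfitHessian F σ x + w := by
    intro x y
    rw [LinearPMap.mem_graph_iff]
    constructor
    · rintro ⟨z, rfl, rfl⟩
      refine ⟨((C : M →ₗ[ℝ] M).toPMap ⊤).inverse ⟨z.1, z.2.2⟩, ?_, ?_⟩
      · exact (hgC _ _).1 (LinearPMap.mem_graph
        ((C : M →ₗ[ℝ] M).toPMap ⊤).inverse ⟨z.1, z.2.2⟩)
      · exact LinearPMap.add_apply _ _ z
    · rintro ⟨w, rfl, rfl⟩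
      have hw := (hgC (C w) w).2 rfl
      have hd := LinearPMap.mem_domain_of_mem_graph hw
      refine ⟨⟨C w, trivial, hd⟩, rfl, ?_⟩
      have hv : ((C : M →ₗ[ℝ] M).toPMap ⊤).inverse ⟨C w, hd⟩ = w :=
        LinearPMap.mem_graph_snd_inj _ (LinearPMap.mem_graph _ ⟨C w, hd⟩) hw rfl
      refine (LinearPMap.add_apply _ _ _).trans ?_
      exact congrArg₂ (· + ·) rfl hv
  have hkP : LinearMap.ker (posteriorPrecision F σ C).toFun = ⊥ := by
    rw [LinearMap.ker_eq_bot']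
    intro u hu
    have hm : (u.1, (0 : M)) ∈ (posteriorPrecision F σ C).graph := by
      rw [LinearPMap.mem_graph_iff]; exact ⟨u, rfl, hu⟩
    obtain ⟨w, hw, h0⟩ := (hgP _ _).1 hm
    have : (S : M →L[ℝ] M) w = 0 := by rw [hS1, ← hw, add_comm, ← h0]
    have hw0 : w = 0 := by rw [← hSi w, this, map_zero]
    exact Subtype.ext (by rw [hw, hw0, map_zero]; rfl)
  have hex : ∃ T : M →L[ℝ] M,
      (T : M →ₗ[ℝ] M).toPMap ⊤ = (posteriorPrecision F σ C).inverse := by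
    refine ⟨C ∘L (S⁻¹ : (M →L[ℝ] M)ˣ).val, LinearPMap.eq_of_eq_graph ?_⟩
    ext ⟨x, y⟩
    rw [mem_graph_toPMap_top, LinearPMap.inverse_graph hkP, Submodule.mem_map]
    constructor
    · rintro rfl
      refine ⟨(C ((S⁻¹ : (M →L[ℝ] M)ˣ).val x), x), (hgP _ _).2 ⟨_, rfl, ?_⟩, rfl⟩
      rw [add_comm, ← hS1, hSi']
    · rintro ⟨⟨p, q⟩, hp, hpq⟩
      obtain ⟨rfl, rfl⟩ : q = x ∧ p = y := by simpa using hpq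
      obtain ⟨w, rfl, hq⟩ := (hgP _ _).1 hp
      have : q = (S : M →L[ℝ] M) w := by rw [hS1, hq, add_comm]
      change C w = C ((S⁻¹ : (M →L[ℝ] M)ˣ).val q)
      rw [this, hSi]
  refine ⟨hkP, ?_⟩
  rw [posteriorCov, dif_pos hex]
  exact hex.choose_spec

end Inverse

/-! ### The quadratic approximation of the goal and the design criterion -/

section Goal

variable {M : Type*} [NormedAddCommGroup M] [InnerProductSpace ℝ M] [CompleteSpace M]

/-- The Hessian `∇²Z(m)` as an operator on `M`: the derivative of the gradient. -/
def goalHessian (Z : M → ℝ) (m : M) : M →L[ℝ] M :=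
  fderiv ℝ (∇ Z) m

/-- The second-order Taylor approximation of `Z` at `mbar`. -/
def quadApprox (Z : M → ℝ) (mbar m : M) : ℝ :=
  Z mbar + ⟪∇ Z mbar, m - mbar⟫ + 1 / 2 * ⟪goalHessian Z mbar (m - mbar), m - mbar⟫

variable [SecondCountableTopology M] [MeasurableSpace M] [BorelSpace M] {d : ℕ}

/-- The posterior variance, given the data `y`, of the quadratic approximation of the goal. The
posterior is the conditional law of `m` given `y`. -/
def posteriorVariance (μ : Measure M) [IsFiniteMeasure μ]
    (F : M →L[ℝ] EuclideanSpace ℝ (Fin d)) (σ : ℝ) (Z : M → ℝ) (mbar : M)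
    (y : EuclideanSpace ℝ (Fin d)) : ℝ :=
  Var[quadApprox Z mbar; posterior (likelihood F σ) μ y]

/-- The criterion `Ψ`: the posterior variance of the quadratic approximation of the goal, averaged
over the likelihood and then over the prior `μ`. -/
def goalCriterion (μ : Measure M) [IsFiniteMeasure μ]
    (F : M →L[ℝ] EuclideanSpace ℝ (Fin d)) (σ : ℝ) (Z : M → ℝ) (mbar : M) : ℝ :=
  ∫ m, ∫ y, posteriorVariance μ F σ Z mbar y ∂(likelihood F σ m) ∂μ

end Goal

end

/-! The posterior is computed by conditioning jointly Gaussian vectors. Let `m ∼ N(mpr, C)` and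
`η ∼ N(0, σ² I)` be independent, `y = F m + η`, let `T = (σ⁻² F* F + C⁻¹)⁻¹`, and let
`K = σ⁻² T F*`. The estimation error `m - K y` is uncorrelated with `y`, hence independent of it,
and its covariance operator is `T`; both facts reduce to the bounded relation
`T (1 + σ⁻² F* F C) = C` and its adjoint (`posteriorCov_apply_add`,
`apply_sub_misfitHessian_posteriorCov`). As `m = K y + (m - K y)`, uniqueness of the posterior
kernel gives that for almost every `y` the posterior is `N(K y + const, T)`
(`ae_isGaussianWith_posterior`), while `K y` is Gaussian with covariance operator `C - T`
(`isGaussianWith_gain_dataMap`).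

For a Gaussian measure `N(m₀, T)` and a quadratic functional with gradient `g` and Hessian `H` at
`z`, the variance is `⟪T b, b⟫ + ½ tr((T H)²)` with `b = g + H (m₀ - z)`
(`IsGaussianWith.variance_quadratic`). No diagonalization and no formula for fourth moments is
needed: the rotation invariance of `ν ⊗ ν` for a centered Gaussian `ν` turns twice the variance into
the second moment of `⟪√2 b + H x, y⟫` for independent `x, y ∼ ν`.

For the posterior, `b` is an affine function of `K y`. Averaging `⟪T b, b⟫` over `y` with the second
moment formula `IsGaussianWith.integral_inner_affine` therefore yields its value at the prior mean
plus `tr((C - T) H T H)`, and the sum with `½ tr((T H)²)` is the asserted closed form. The traces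
exist because covariance operators of Gaussian measures are trace class
(`IsGaussianWith.isTraceClass`), a consequence of Fernique's theorem. -/

/-! ### Trace class operators -/

theorem HilbertBasis.countable {M : Type*} [NormedAddCommGroup M] [InnerProductSpace ℝ M]
    [SecondCountableTopology M] {ι : Type*} (e : HilbertBasis ι ℝ M) :
    Countable ι := by
  have hd : ∀ i j, i ≠ j → 1 ≤ dist (e i) (e j) := by
    intro i j hij
    have h : dist (e i) (e j) ^ 2 = 2 := by
      rw [dist_eq_norm, norm_sub_sq_real, e.orthonormal.2 hij, e.orthonormal.1, e.orthonormal.1]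
      norm_num
    nlinarith [dist_nonneg (x := e i) (y := e j)]
  have hinj : Function.Injective e := e.orthonormal.linearIndependent.injective
  have : DiscreteTopology (Set.range e) := by
    refine DiscreteTopology.of_forall_le_dist one_pos ?_
    rintro ⟨_, i, rfl⟩ ⟨_, j, rfl⟩ hij
    exact hd i j fun h => hij (by rw [h])
  have : Countable (Set.range e) := TopologicalSpace.separableSpace_iff_countable.1 inferInstance
  exact (Set.rangeFactorization_injective.2 hinj).countable

section TraceClassLemmas

variable {M : Type*} [NormedAddCommGroup M] [InnerProductSpace ℝ M] [CompleteSpace M]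

theorem IsTraceClass.comp_right {T : M →L[ℝ] M} (hT : IsTraceClass T) (B : M →L[ℝ] M) :
    IsTraceClass (T ∘L B) := by
  obtain ⟨a, b, hab, h⟩ := hT
  refine ⟨fun k => B.adjoint (a k), b, ?_, fun x => ?_⟩
  · refine Summable.of_nonneg_of_le (fun k => by positivity) (fun k => ?_)
      (hab.mul_left ‖B.adjoint‖)
    rw [← mul_assoc]
    gcongr
    exact B.adjoint.le_opNorm _
  · simpa [ContinuousLinearMap.adjoint_inner_left] using h (B x)

theorem operatorTrace_add {S T U : M →L[ℝ] M} (hS : IsTraceClass S) (hT : IsTraceClass T)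
    (hU : IsTraceClass U) (h : ∀ x, U x = S x + T x) :
    operatorTrace U = operatorTrace S + operatorTrace T := by
  obtain ⟨w, e, -⟩ := exists_hilbertBasis ℝ M
  refine (hU.hasSum_trace e).unique ?_
  simpa only [h, inner_add_right] using (hS.hasSum_trace e).add (hT.hasSum_trace e)

/-- If `A` is Hilbert–Schmidt, then `A* A` is trace class: for an orthonormal basis `f` of the
target, `A* A x = ∑ₖ ⟪A* fₖ, x⟫ A* fₖ`, and `∑ₖ ‖A* fₖ‖² = ∑ᵢ ‖A eᵢ‖²`. -/
theorem isTraceClass_adjoint_comp_self {N : Type*} [NormedAddCommGroup N] [InnerProductSpace ℝ N]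
    [CompleteSpace N] (A : M →L[ℝ] N) {ι : Type*} (e : HilbertBasis ι ℝ M) {B : ℝ}
    (hB : ∀ s : Finset ι, ∑ i ∈ s, ‖A (e i)‖ ^ 2 ≤ B) :
    IsTraceClass (A.adjoint ∘L A) := by
  obtain ⟨w, f, -⟩ := exists_hilbertBasis ℝ N
  set c : w → M := fun k => A.adjoint (f k) with hc
  have hsumA : Summable fun i => ‖A (e i)‖ ^ 2 := summable_of_sum_le (fun _ => sq_nonneg _) hB
  have hcs : Summable fun k => ‖c k‖ ^ 2 := by
    refine summable_of_sum_le (c := ∑' i, ‖A (e i)‖ ^ 2) (fun _ => sq_nonneg _) fun s => ?_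
    have h1 : HasSum (fun i => ∑ k ∈ s, ⟪c k, e i⟫ * ⟪e i, c k⟫) (∑ k ∈ s, ‖c k‖ ^ 2) := by
      refine hasSum_sum fun k _ => ?_
      simpa using e.hasSum_inner_mul_inner (c k) (c k)
    refine hasSum_le (fun i => ?_) h1 hsumA.hasSum
    refine le_trans (le_of_eq ?_) (f.orthonormal.sum_inner_products_le (A (e i)) (s := s))
    refine Finset.sum_congr rfl fun k _ => ?_
    rw [real_inner_comm (c k) (e i), hc, ContinuousLinearMap.adjoint_inner_left,
      Real.norm_eq_abs, sq_abs, sq]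
  -- only countably many of the vectors `c k` are nonzero; these are re-indexed by `ℕ`
  set t : Set w := Function.support fun k => ‖c k‖ ^ 2
  have htc : Countable t := hcs.countable_support.to_subtype
  obtain ⟨g, hg⟩ := exists_injective_nat t
  refine ⟨Function.extend g (fun k : t => c k) 0, Function.extend g (fun k : t => c k) 0, ?_,
    fun x => ?_⟩
  · have h1 : Summable (Function.extend g (fun k : t => ‖c k‖ ^ 2) 0) :=
      ((hasSum_extend_zero hg).2 (hcs.subtype t).hasSum).summable
    convert h1 using 2 with n
    by_cases hn : ∃ k, g k = n
    · obtain ⟨k, rfl⟩ := hn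
      simp only [hg.extend_apply, sq]
    · simp [Function.extend_apply' _ _ _ hn]
  · have h1 : HasSum (fun k => ⟪c k, x⟫ • c k) (A.adjoint (A x)) := by
      have := (f.hasSum_repr (A x)).mapL A.adjoint
      simpa [hc, ContinuousLinearMap.adjoint_inner_left, f.repr_apply_apply] using this
    have h2 : HasSum (fun k : t => ⟪c k, x⟫ • c k) (A.adjoint (A x)) := by
      refine (hasSum_subtype_iff_of_support_subset (f := fun k => ⟪c k, x⟫ • c k) ?_).2 h1
      intro k hk hk0
      have : c k = 0 := by simpa using hk0
      exact hk (by simp [this])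
    have h3 := (hasSum_extend_zero hg).2 h2
    change HasSum _ (A.adjoint (A x))
    convert h3 using 2 with n
    by_cases hn : ∃ k, g k = n
    · obtain ⟨k, rfl⟩ := hn
      simp only [hg.extend_apply]
    · simp [Function.extend_apply' _ _ _ hn]

end TraceClassLemmas

/-! ### The posterior covariance operator -/

section PosteriorCov

variable {M : Type*} [NormedAddCommGroup M] [InnerProductSpace ℝ M] [CompleteSpace M] {d : ℕ}
  (F : M →L[ℝ] EuclideanSpace ℝ (Fin d)) (σ : ℝ) {C : M →L[ℝ] M}

theorem inner_misfitHessian_comm (u v : M) :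
    ⟪misfitHessian F σ u, v⟫ = ⟪u, misfitHessian F σ v⟫ := by
  simp [misfitHessian, real_inner_smul_left, real_inner_smul_right,
    ContinuousLinearMap.adjoint_inner_left, ContinuousLinearMap.adjoint_inner_right]

/-- The bounded form `T (1 + σ⁻² F* F C) = C` of `T = (σ⁻² F* F + C⁻¹)⁻¹`. -/
theorem posteriorCov_apply_add (hC : ∀ u : M, u ≠ 0 → 0 < ⟪C u, u⟫) (w : M) :
    posteriorCov F σ C (w + misfitHessian F σ (C w)) = C w := by
  have hkC : LinearMap.ker ((C : M →ₗ[ℝ] M).toPMap ⊤).toFun = ⊥ := by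
    rw [LinearMap.ker_eq_bot']
    intro u hu
    by_contra hne
    have h1 := hC u.1 (fun h => hne (Subtype.ext h))
    have h2 : C u.1 = 0 := hu
    rw [h2, inner_zero_left] at h1
    exact lt_irrefl _ h1
  obtain ⟨hkP, hT⟩ := posteriorCov_spec F σ hC
  have hw : (C w, w) ∈ (((C : M →ₗ[ℝ] M).toPMap ⊤).inverse).graph := by
    rw [LinearPMap.inverse_graph hkC, Submodule.mem_map]
    exact ⟨(w, C w), (mem_graph_toPMap_top _ _ _).2 rfl, rfl⟩
  have hd := LinearPMap.mem_domain_of_mem_graph hw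
  have hv : ((C : M →ₗ[ℝ] M).toPMap ⊤).inverse ⟨C w, hd⟩ = w :=
    LinearPMap.mem_graph_snd_inj _ (LinearPMap.mem_graph _ ⟨C w, hd⟩) hw rfl
  have hP : (C w, w + misfitHessian F σ (C w)) ∈ (posteriorPrecision F σ C).graph := by
    rw [LinearPMap.mem_graph_iff]
    refine ⟨⟨C w, trivial, hd⟩, rfl, ?_⟩
    refine (LinearPMap.add_apply _ _ _).trans ?_
    rw [add_comm w]
    exact congrArg₂ (· + ·) rfl hv
  have hI : (w + misfitHessian F σ (C w), C w) ∈
      ((posteriorCov F σ C : M →ₗ[ℝ] M).toPMap ⊤).graph := by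
    rw [hT, LinearPMap.inverse_graph hkP, Submodule.mem_map]
    exact ⟨_, hP, rfl⟩
  exact ((mem_graph_toPMap_top _ _ _).1 hI).symm

theorem inner_posteriorCov_comm (hC : ∀ u : M, u ≠ 0 → 0 < ⟪C u, u⟫)
    (hCs : ∀ u v : M, ⟪C u, v⟫ = ⟪u, C v⟫) (u v : M) :
    ⟪posteriorCov F σ C u, v⟫ = ⟪u, posteriorCov F σ C v⟫ := by
  obtain ⟨S, hS⟩ := isUnit_one_add_misfitHessian_comp F σ hC
  have hS' : ∀ u, ∃ p, u = p + misfitHessian F σ (C p) := fun u => by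
    refine ⟨(S⁻¹ : (M →L[ℝ] M)ˣ).val u, ?_⟩
    have h := congrArg (fun T : M →L[ℝ] M => T u) S.mul_inv
    rw [hS] at h
    exact h.symm
  obtain ⟨p, rfl⟩ := hS' u
  obtain ⟨q, rfl⟩ := hS' v
  rw [posteriorCov_apply_add F σ hC, posteriorCov_apply_add F σ hC, inner_add_left, inner_add_right,
    inner_misfitHessian_comm, hCs p q]

/-- The adjoint form `C (1 - σ⁻² F* F T) = T` of the relation defining the posterior covariance
operator `T`. -/
theorem apply_sub_misfitHessian_posteriorCov (hC : ∀ u : M, u ≠ 0 → 0 < ⟪C u, u⟫)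
    (hCs : ∀ u v : M, ⟪C u, v⟫ = ⟪u, C v⟫) (u : M) :
    C (u - misfitHessian F σ (posteriorCov F σ C u)) = posteriorCov F σ C u := by
  refine ext_inner_right ℝ fun v => ?_
  have h := posteriorCov_apply_add F σ hC v
  rw [map_add, ← eq_sub_iff_add_eq] at h
  rw [hCs, inner_sub_left, inner_misfitHessian_comm, inner_posteriorCov_comm F σ hC hCs,
    inner_posteriorCov_comm F σ hC hCs, ← inner_sub_right, ← h]

end PosteriorCov

/-! ### Quadratic functionals of Gaussian measures -/

section GaussianMoments

theorem IsGaussianWith.integral_inner_mul_inner {M : Type*} [NormedAddCommGroup M]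
    [InnerProductSpace ℝ M] [MeasurableSpace M] {ν : Measure M} {T : M →L[ℝ] M}
    (h : IsGaussianWith ν 0 T) (u v : M) : ∫ s, ⟪u, s⟫ * ⟪v, s⟫ ∂ν = ⟪T u, v⟫ := by
  rw [h.covariance]
  simp

variable {M : Type*} [NormedAddCommGroup M] [InnerProductSpace ℝ M] [CompleteSpace M]
  [SecondCountableTopology M] [MeasurableSpace M] [BorelSpace M]
  {ν : Measure M} {m : M} {T : M →L[ℝ] M}

theorem IsGaussianWith.integral_id (h : IsGaussianWith ν m T) : ∫ s, s ∂ν = m := by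
  have := h.isGaussian
  refine (ext_inner_right ℝ fun v => ?_).symm
  rw [h.mean, real_inner_comm, ← integral_inner IsGaussian.integrable_fun_id]
  simp_rw [real_inner_comm]

theorem isGaussianWith_of_covariance [IsGaussian ν] (hm : ∫ s, s ∂ν = m)
    (hT : ∀ u v : M, cov[fun s => ⟪u, s⟫, fun s => ⟪v, s⟫; ν] = ⟪T u, v⟫) :
    IsGaussianWith ν m T := by
  have hi : ∀ u : M, ∫ s, ⟪u, s⟫ ∂ν = ⟪u, m⟫ := fun u => by
    rw [integral_inner IsGaussian.integrable_fun_id, hm]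
  refine ⟨inferInstance, fun v => ?_, fun u v => ?_⟩
  · simp_rw [real_inner_comm v, hi]
  · rw [← hT, covariance]
    simp_rw [hi, inner_sub_right]

theorem IsGaussianWith.covariance_inner (h : IsGaussianWith ν m T) (u v : M) :
    cov[fun s => ⟪u, s⟫, fun s => ⟪v, s⟫; ν] = ⟪T u, v⟫ := by
  have := h.isGaussian
  have hi : ∀ u : M, ∫ s, ⟪u, s⟫ ∂ν = ⟪u, m⟫ := fun u => by
    rw [integral_inner IsGaussian.integrable_fun_id, h.integral_id]
  rw [h.covariance, ProbabilityTheory.covariance]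
  simp_rw [hi, inner_sub_right]

theorem IsGaussianWith.inner_comm (h : IsGaussianWith ν m T) (u v : M) :
    ⟪T u, v⟫ = ⟪u, T v⟫ := by
  rw [← h.covariance_inner u v, covariance_comm, h.covariance_inner, real_inner_comm]

theorem IsGaussianWith.map_const_add (h : IsGaussianWith ν m T) (c : M) :
    IsGaussianWith (ν.map fun s => c + s) (c + m) T := by
  have := h.isGaussian
  refine isGaussianWith_of_covariance ?_ fun u v => ?_
  · rw [integral_map (by fun_prop) (by fun_prop),
      integral_add (integrable_const _) IsGaussian.integrable_fun_id, h.integral_id]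
    simp
  · rw [covariance_map_fun (by fun_prop) (by fun_prop) (by fun_prop)]
    simp_rw [inner_add_right]
    rw [covariance_const_add_left, covariance_const_add_right, h.covariance_inner]
    all_goals exact (IsGaussian.integrable_fun_id).const_inner _

theorem IsGaussianWith.memLp_norm_pow_two (h : IsGaussianWith ν m T) :
    MemLp (fun s => ‖s‖ ^ 2) 2 ν := by
  have := h.isGaussian
  have h4 : MemLp (fun s : M => s) 4 ν := IsGaussian.memLp_id ν 4 (by norm_num)
  have := h4.norm_rpow_div 2
  have h42 : (4 : ENNReal) / 2 = 2 := by
    rw [show (4 : ENNReal) = 2 * 2 by norm_num]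
    exact ENNReal.mul_div_cancel_right (by norm_num) (by norm_num)
  rw [h42] at this
  simpa using this

theorem IsGaussianWith.memLp_quadratic (h : IsGaussianWith ν m T) (c : ℝ) (b : M)
    (H : M →L[ℝ] M) : MemLp (fun s => c + ⟪b, s⟫ + 1 / 2 * ⟪H s, s⟫) 2 ν := by
  have := h.isGaussian
  refine MemLp.add (MemLp.add (memLp_const c) ?_) (MemLp.const_mul ?_ _)
  · exact (IsGaussian.memLp_two_id (μ := ν)).const_inner b
  · refine (h.memLp_norm_pow_two.const_mul ‖H‖).mono (by fun_prop) (ae_of_all _ fun s => ?_)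
    rw [Real.norm_of_nonneg (by positivity : 0 ≤ ‖H‖ * ‖s‖ ^ 2)]
    calc ‖⟪H s, s⟫‖ ≤ ‖H s‖ * ‖s‖ := norm_inner_le_norm _ _
      _ ≤ ‖H‖ * ‖s‖ * ‖s‖ := by gcongr; exact H.le_opNorm s
      _ = ‖H‖ * ‖s‖ ^ 2 := by ring

theorem IsGaussianWith.integrable_inner_apply (h : IsGaussianWith ν m T) (A : M →L[ℝ] M) :
    Integrable (fun s => ⟪A s, s⟫) ν := by
  have := h.isGaussian
  have h1 := (h.memLp_quadratic 0 0 A).integrable (by norm_num)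
  have h2 := h1.const_mul 2
  refine h2.congr (ae_of_all _ fun s => ?_)
  simp

/-- The covariance operator of a Gaussian measure is trace class: it is `A* A` for the map
`A : M → L²(ν)`, `u ↦ ⟪u, ·⟫`, and `∑ᵢ ‖A eᵢ‖² = ∫ ‖s‖² dν`. -/
theorem IsGaussianWith.isTraceClass (h : IsGaussianWith ν m T) : IsTraceClass T := by
  -- the covariance operator does not depend on the mean
  wlog hm : m = 0 generalizing ν m
  · exact this (h.map_const_add (-m)) (by simp)
  subst hm
  have := h.isGaussian
  obtain ⟨w, e, -⟩ := exists_hilbertBasis ℝ M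
  have h2 : MemLp id 2 ν := IsGaussian.memLp_two_id
  let A : M →L[ℝ] Lp ℝ 2 ν :=
    StrongDual.toLp ν 2 ∘L (InnerProductSpace.toDualMap ℝ M).toContinuousLinearMap
  have hA : ∀ u v, ⟪A u, A v⟫ = ⟪T u, v⟫ := fun u v => by
    rw [← h.integral_inner_mul_inner]
    exact uncenteredCovarianceBilinDual_apply h2 _ _
  have hT : T = A.adjoint ∘L A := by
    ext u
    refine ext_inner_right ℝ fun v => ?_
    rw [ContinuousLinearMap.comp_apply, ContinuousLinearMap.adjoint_inner_left, hA]
  rw [hT]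
  refine isTraceClass_adjoint_comp_self A e (B := ∫ s, ‖s‖ ^ 2 ∂ν) fun t => ?_
  have hi : ∀ u : M, Integrable (fun s => ⟪u, s⟫ * ⟪u, s⟫) ν := fun u =>
    (h2.const_inner u).integrable_mul (h2.const_inner u)
  simp_rw [← real_inner_self_eq_norm_sq (A _), hA, ← h.integral_inner_mul_inner]
  rw [← integral_finsetSum _ fun i _ => hi _]
  refine integral_mono (integrable_finsetSum _ fun i _ => hi _)
    (h.memLp_norm_pow_two.integrable (by norm_num)) fun s => ?_
  refine le_trans (le_of_eq ?_) (e.orthonormal.sum_inner_products_le s (s := t))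
  exact Finset.sum_congr rfl fun i _ => by rw [Real.norm_eq_abs, sq_abs, sq]

/-- The second moment formula `E ⟪A s, s⟫ = tr(T A)` for `s ∼ N(0, T)`. -/
theorem IsGaussianWith.integral_inner_apply (h : IsGaussianWith ν 0 T) {A : M →L[ℝ] M}
    (hA : ∀ u v, ⟪A u, v⟫ = ⟪u, A v⟫) :
    ∫ s, ⟪A s, s⟫ ∂ν = operatorTrace (T ∘L A) := by
  have := h.isGaussian
  obtain ⟨w, e, -⟩ := exists_hilbertBasis ℝ M
  have := e.countable
  have h2 : MemLp id 2 ν := IsGaussian.memLp_two_id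
  have hi : ∀ u v : M, Integrable (fun s => ⟪u, s⟫ * ⟪v, s⟫) ν := fun u v =>
    (h2.const_inner u).integrable_mul (h2.const_inner v)
  have hF : ∀ i, (fun s => ⟪A s, e i⟫ * ⟪e i, s⟫) = fun s => ⟪A (e i), s⟫ * ⟪e i, s⟫ := fun i => by
    funext s
    rw [hA, real_inner_comm]
  have hb : ∀ s : M, ∀ t : Finset w, ∑ i ∈ t, ‖⟪A (e i), s⟫ * ⟪e i, s⟫‖ ≤ ‖A‖ * ‖s‖ ^ 2 := by
    intro s t
    have h1 := e.orthonormal.sum_inner_products_le (A s) (s := t)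
    have h2 := e.orthonormal.sum_inner_products_le s (s := t)
    have hcs := Finset.sum_mul_sq_le_sq_mul_sq t (fun i => ‖⟪e i, A s⟫‖) (fun i => ‖⟪e i, s⟫‖)
    have heq : ∑ i ∈ t, ‖⟪A (e i), s⟫ * ⟪e i, s⟫‖ = ∑ i ∈ t, ‖⟪e i, A s⟫‖ * ‖⟪e i, s⟫‖ :=
      Finset.sum_congr rfl fun i _ => by rw [norm_mul, hA]
    rw [heq]
    have h3 : ‖A s‖ ^ 2 ≤ (‖A‖ * ‖s‖) ^ 2 := by gcongr; exact A.le_opNorm s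
    refine abs_le_of_sq_le_sq' ?_ (by positivity) |>.2
    calc _ ≤ _ := hcs
      _ ≤ ‖A s‖ ^ 2 * ‖s‖ ^ 2 := by gcongr
      _ ≤ (‖A‖ * ‖s‖) ^ 2 * ‖s‖ ^ 2 := by gcongr
      _ = (‖A‖ * ‖s‖ ^ 2) ^ 2 := by ring
  have hs : HasSum (fun i => ∫ s, ⟪A (e i), s⟫ * ⟪e i, s⟫ ∂ν)
      (∫ s, ∑' i, ⟪A (e i), s⟫ * ⟪e i, s⟫ ∂ν) := by
    refine hasSum_integral_of_summable_integral_norm (fun i => hi _ _) ?_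
    refine summable_of_sum_le (c := ∫ s, ‖A‖ * ‖s‖ ^ 2 ∂ν)
      (fun i => integral_nonneg fun _ => norm_nonneg _) fun t => ?_
    rw [← integral_finsetSum _ fun i _ => (hi _ _).norm]
    exact integral_mono (integrable_finsetSum _ fun i _ => (hi _ _).norm)
      ((h.memLp_norm_pow_two.integrable (by norm_num)).const_mul _) fun s => hb s t
  have htsum : ∀ s, ∑' i, ⟪A (e i), s⟫ * ⟪e i, s⟫ = ⟪A s, s⟫ := fun s => by
    rw [← (e.hasSum_inner_mul_inner (A s) s).tsum_eq]
    exact tsum_congr fun i => (congrFun (hF i) s).symm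
  simp_rw [htsum, h.integral_inner_mul_inner] at hs
  refine hs.unique ?_
  convert (h.isTraceClass.comp_right A).hasSum_trace e using 2 with i
  rw [ContinuousLinearMap.comp_apply, real_inner_comm]

theorem IsGaussianWith.integrable_inner_affine (h : IsGaussianWith ν m T) (S H : M →L[ℝ] M)
    (g : M) : Integrable (fun s => ⟪S (g + H s), g + H s⟫) ν := by
  have := h.isGaussian
  have h1 : MemLp (fun s : M => s) 2 ν := IsGaussian.memLp_two_id
  have h2 : MemLp (fun s => g + H s) 2 ν := (memLp_const g).add (H.comp_memLp' h1)
  refine (h2.integrable_norm_pow (by norm_num) |>.const_mul ‖S‖).mono' (by fun_prop)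
    (ae_of_all _ fun s => ?_)
  calc ‖⟪S (g + H s), g + H s⟫‖ ≤ ‖S (g + H s)‖ * ‖g + H s‖ := norm_inner_le_norm _ _
    _ ≤ ‖S‖ * ‖g + H s‖ * ‖g + H s‖ := by gcongr; exact S.le_opNorm _
    _ = ‖S‖ * ‖g + H s‖ ^ 2 := by ring

/-- For `s ∼ N(m, T)`, the mean of the quadratic form `S` at the affine image `g + H (s - z)` is
the sum of its value at the mean of that image and of a trace. -/
theorem IsGaussianWith.integral_inner_affine (h : IsGaussianWith ν m T) {S H : M →L[ℝ] M}
    (hS : ∀ u v, ⟪S u, v⟫ = ⟪u, S v⟫) (hH : ∀ u v, ⟪H u, v⟫ = ⟪u, H v⟫) (g z : M) :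
    ∫ s, ⟪S (g + H (s - z)), g + H (s - z)⟫ ∂ν =
      ⟪S (g + H (m - z)), g + H (m - z)⟫ + operatorTrace (T ∘L H ∘L S ∘L H) := by
  have h0 := h.map_const_add (-m)
  rw [neg_add_cancel] at h0
  set ν₀ := ν.map fun s => -m + s with hν₀
  have := h0.isGaussian
  have := h.isGaussian
  set b := g + H (m - z) with hb
  have h1 : ∫ s, ⟪S (g + H (s - z)), g + H (s - z)⟫ ∂ν = ∫ s, ⟪S (b + H s), b + H s⟫ ∂ν₀ := by
    rw [hν₀, integral_map (by fun_prop) (by fun_prop)]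
    have : ∀ s, g + H (s - z) = b + H (-m + s) := fun s => by
      rw [hb, add_assoc, ← map_add]
      congr 2
      abel
    simp_rw [this]
  have h2 : ∀ s, ⟪S (b + H s), b + H s⟫ =
      ⟪S b, b⟫ + ⟪(2 : ℝ) • H (S b), s⟫ + ⟪(H ∘L S ∘L H) s, s⟫ := fun s => by
    simp only [map_add, inner_add_left, inner_add_right, real_inner_smul_left,
      ContinuousLinearMap.comp_apply, hH, hS (H s) b]
    rw [real_inner_comm (H s) (S b), hH s]
    simp only [hS, hH]
    ring
  have hi1 : Integrable (fun s => ⟪(2 : ℝ) • H (S b), s⟫) ν₀ :=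
    IsGaussian.integrable_fun_id.const_inner _
  have hi2 := h0.integrable_inner_apply (H ∘L S ∘L H)
  rw [h1]
  simp_rw [h2]
  rw [integral_add (by exact (integrable_const _).add hi1) hi2,
    integral_add (integrable_const _) hi1, integral_inner IsGaussian.integrable_fun_id,
    h0.integral_id, inner_zero_right, integral_const,
    h0.integral_inner_apply fun u v => by simp [hS, hH]]
  simp

/-- The variance of `Q s = c + ⟪b, s⟫ + ½ ⟪H s, s⟫` under a centered Gaussian measure. By the
rotation invariance of `ν ⊗ ν`, `2 Var Q = E (Q x - Q y)² = E ⟪√2 b + H x, y⟫²`, and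
integrating out `y` leaves the mean of a quadratic form in `x`. -/
theorem IsGaussianWith.variance_quadratic_of_centered (h : IsGaussianWith ν 0 T)
    {H : M →L[ℝ] M} (hH : ∀ u v, ⟪H u, v⟫ = ⟪u, H v⟫) (c : ℝ) (b : M) :
    Var[fun s => c + ⟪b, s⟫ + 1 / 2 * ⟪H s, s⟫; ν] =
      ⟪T b, b⟫ + 1 / 2 * operatorTrace (T ∘L H ∘L T ∘L H) := by
  have := h.isGaussian
  set Q : M → ℝ := fun s => c + ⟪b, s⟫ + 1 / 2 * ⟪H s, s⟫ with hQdef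
  have hQ : MemLp Q 2 ν := h.memLp_quadratic c b H
  -- rotation by `-π/4` sends `(x, y)` to `((x - y) / √2, (x + y) / √2)`
  have hrot := IsGaussian.map_rotation_eq_self (μ := ν) h.integral_id (-(Real.pi / 4))
  set r : M × M →L[ℝ] M × M := ContinuousLinearMap.rotation (-(Real.pi / 4)) with hr
  have hdiff : ∀ p : M × M, Q (r p).1 - Q (r p).2 = -⟪√2 • b + H p.1, p.2⟫ := by
    rintro ⟨x, y⟩
    have h2 : √2 * √2 = 2 := Real.mul_self_sqrt (by norm_num)
    simp only [hr, ContinuousLinearMap.rotation_apply, Real.cos_neg, Real.sin_neg,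
      Real.cos_pi_div_four, Real.sin_pi_div_four, hQdef, inner_add_right, inner_add_left, map_add,
      map_smul, real_inner_smul_left, real_inner_smul_right, map_neg, inner_neg_left,
      inner_neg_right, neg_smul, neg_neg]
    rw [hH y x, real_inner_comm (H x) y]
    linear_combination (-1 / 2 * ⟪H x, y⟫) * h2
  have hQQ : MemLp (fun p : M × M => Q p.1 + -Q p.2) 2 (ν.prod ν) :=
    (hQ.comp_fst ν).add (hQ.neg.comp_snd ν)
  have hvar : Var[fun p : M × M => Q p.1 + -Q p.2; ν.prod ν] = 2 * Var[Q; ν] := by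
    rw [variance_add_prod (Y := fun s => -Q s) hQ hQ.neg, variance_fun_neg]
    ring
  have hmean : ∫ p : M × M, Q p.1 + -Q p.2 ∂(ν.prod ν) = 0 := by
    have hi := hQ.integrable (by norm_num)
    rw [integral_add (hi.comp_fst ν) (by exact hi.neg.comp_snd ν), integral_fun_fst,
      integral_fun_snd (f := fun s => -Q s)]
    simp [integral_neg]
  have hsq : ∫ p : M × M, (Q p.1 + -Q p.2) ^ 2 ∂(ν.prod ν) =
      ∫ p : M × M, ⟪√2 • b + H p.1, p.2⟫ ^ 2 ∂(ν.prod ν) := by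
    conv_lhs => rw [← hrot]
    rw [integral_map (by fun_prop) (by fun_prop)]
    refine integral_congr_ae (ae_of_all _ fun p => ?_)
    simp only [← sub_eq_add_neg, hdiff, neg_sq]
  have hint : Integrable (fun p : M × M => ⟪√2 • b + H p.1, p.2⟫ ^ 2) (ν.prod ν) := by
    have h1 := hQQ.integrable_sq
    rw [← hrot, integrable_map_measure (by fun_prop) (by fun_prop)] at h1
    refine h1.congr (ae_of_all _ fun p => ?_)
    simp only [Function.comp_apply, ← sub_eq_add_neg, hdiff, neg_sq]
  have hinner : ∀ x, ∫ y, ⟪√2 • b + H x, y⟫ ^ 2 ∂ν =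
      ⟪T (√2 • b + H (x - 0)), √2 • b + H (x - 0)⟫ := fun x => by
    simp_rw [sq, h.integral_inner_mul_inner, sub_zero]
  rw [variance_of_integral_eq_zero (by fun_prop) hmean, hsq, integral_prod _ hint] at hvar
  simp_rw [hinner] at hvar
  rw [h.integral_inner_affine h.inner_comm hH] at hvar
  have h2 : √2 * √2 = 2 := Real.mul_self_sqrt (by norm_num)
  simp only [sub_zero, map_zero, add_zero, map_smul, real_inner_smul_left,
    real_inner_smul_right] at hvar
  rw [← mul_assoc, h2] at hvar
  linarith

theorem IsGaussianWith.variance_quadratic (h : IsGaussianWith ν m T)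
    {H : M →L[ℝ] M} (hH : ∀ u v, ⟪H u, v⟫ = ⟪u, H v⟫) (c : ℝ) (g z : M) :
    MemLp (fun s => c + ⟪g, s - z⟫ + 1 / 2 * ⟪H (s - z), s - z⟫) 2 ν ∧
    Var[fun s => c + ⟪g, s - z⟫ + 1 / 2 * ⟪H (s - z), s - z⟫; ν] =
      ⟪T (g + H (m - z)), g + H (m - z)⟫ + 1 / 2 * operatorTrace (T ∘L H ∘L T ∘L H) := by
  have := h.isGaussian
  have h0 := h.map_const_add (-m)
  rw [neg_add_cancel] at h0
  set c' : ℝ := c + ⟪g, m - z⟫ + 1 / 2 * ⟪H (m - z), m - z⟫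
  have hQ : (fun s => c + ⟪g, s - z⟫ + 1 / 2 * ⟪H (s - z), s - z⟫) =
      (fun s => c' + ⟪g + H (m - z), s⟫ + 1 / 2 * ⟪H s, s⟫) ∘ fun s => -m + s := by
    funext s
    have hs : s - z = (m - z) + (-m + s) := by abel
    have h1 := hH (-m + s) (m - z)
    rw [real_inner_comm] at h1
    simp only [Function.comp_apply, hs, c']
    generalize -m + s = t at *
    generalize m - z = u at *
    simp only [map_add, inner_add_left, inner_add_right]
    rw [hH u t, hH t u, h1]
    ring
  constructor
  · rw [hQ]
    exact (memLp_map_measure_iff (by fun_prop) (by fun_prop)).1 (h0.memLp_quadratic _ _ _)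
  · rw [← h0.variance_quadratic_of_centered hH c', variance_map (by fun_prop) (by fun_prop), hQ]

end GaussianMoments

/-! ### The law of the data and the posterior -/

theorem compProd_eq_map_prod {α β γ : Type*} [MeasurableSpace α] [MeasurableSpace β]
    [MeasurableSpace γ] {μ : Measure α} [SFinite μ] {ρ : Measure γ} [SFinite ρ] {κ : Kernel α β}
    [IsSFiniteKernel κ] {g : α × γ → β} (hg : Measurable g)
    (hκ : ∀ a, κ a = ρ.map fun z => g (a, z)) :
    μ ⊗ₘ κ = (μ.prod ρ).map fun p => (p.1, g p) := by
  ext s hs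
  have hm : Measurable fun p : α × γ => (p.1, g p) := by fun_prop
  rw [Measure.compProd_apply hs, Measure.map_apply hm hs, Measure.prod_apply (hm hs)]
  refine lintegral_congr fun a => ?_
  rw [hκ, Measure.map_apply (by fun_prop) (measurable_prodMk_left hs)]
  rfl

section Noise

/-- The law `N(0, σ² I)` of the observation noise. -/
noncomputable def noise (d : ℕ) (σ : ℝ) : Measure (EuclideanSpace ℝ (Fin d)) :=
  multivariateGaussian 0 (σ ^ 2 • (1 : Matrix (Fin d) (Fin d) ℝ))

theorem isGaussianWith_noise (d : ℕ) (σ : ℝ) :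
    IsGaussianWith (noise d σ) 0 (σ ^ 2 • ContinuousLinearMap.id ℝ _) := by
  have hS : (σ ^ 2 • (1 : Matrix (Fin d) (Fin d) ℝ)).PosSemidef :=
    Matrix.PosSemidef.one.smul (sq_nonneg σ)
  have : IsGaussian (noise d σ) := by unfold noise; infer_instance
  refine isGaussianWith_of_covariance (by simp [noise]) fun u v => ?_
  rw [← covarianceBilin_apply_eq_cov IsGaussian.memLp_two_id, noise,
    covarianceBilin_multivariateGaussian hS]
  simp [Matrix.smul_mulVec, EuclideanSpace.inner_eq_star_dotProduct, dotProduct_comm]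

theorem likelihood_apply {M : Type*} [NormedAddCommGroup M] [InnerProductSpace ℝ M]
    [MeasurableSpace M] [BorelSpace M] {d : ℕ} (F : M →L[ℝ] EuclideanSpace ℝ (Fin d)) (σ : ℝ)
    (m : M) : likelihood F σ m = (noise d σ).map fun z => F m + z := by
  rw [noise, multivariateGaussian, Measure.map_map (by fun_prop) (by fun_prop)]
  simp only [Function.comp_def, zero_add]
  rfl

variable {M : Type*} [NormedAddCommGroup M] [InnerProductSpace ℝ M] [CompleteSpace M]
  [SecondCountableTopology M] [MeasurableSpace M] [BorelSpace M] {d : ℕ}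

/-- Covariances of linear functionals of independent Gaussian vectors `X` and `η`. -/
theorem covariance_prod {E : Type*} [NormedAddCommGroup E] [InnerProductSpace ℝ E]
    [CompleteSpace E] [SecondCountableTopology E] [MeasurableSpace E] [BorelSpace E]
    {μ : Measure M} {m : M} {C : M →L[ℝ] M} (hμ : IsGaussianWith μ m C)
    {ρ : Measure E} {n : E} {D : E →L[ℝ] E} (hρ : IsGaussianWith ρ n D) (a b : M) (p q : E) :
    cov[fun ω : M × E => ⟪a, ω.1⟫ + ⟪p, ω.2⟫, fun ω => ⟪b, ω.1⟫ + ⟪q, ω.2⟫; μ.prod ρ] =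
      ⟪C a, b⟫ + ⟪D p, q⟫ := by
  have := hμ.isGaussian
  have := hρ.isGaussian
  have hX : ∀ a : M, MemLp (fun s => ⟪a, s⟫) 2 μ := fun a =>
    IsGaussian.memLp_two_id.const_inner a
  have hY : ∀ p : E, MemLp (fun s => ⟪p, s⟫) 2 ρ := fun p =>
    IsGaussian.memLp_two_id.const_inner p
  have hX' : ∀ a : M, MemLp (fun ω : M × E => ⟪a, ω.1⟫) 2 (μ.prod ρ) := fun a => (hX a).comp_fst ρ
  have hY' : ∀ p : E, MemLp (fun ω : M × E => ⟪p, ω.2⟫) 2 (μ.prod ρ) := fun p => (hY p).comp_snd μ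
  have h11 : cov[fun ω : M × E => ⟪a, ω.1⟫, fun ω => ⟪b, ω.1⟫; μ.prod ρ] = ⟪C a, b⟫ := by
    rw [← hμ.covariance_inner]
    conv_rhs => rw [← Measure.fst_prod (μ := μ) (ν := ρ), Measure.fst]
    rw [covariance_map_fun (by fun_prop) (by fun_prop) (by fun_prop)]
  have h22 : cov[fun ω : M × E => ⟪p, ω.2⟫, fun ω => ⟪q, ω.2⟫; μ.prod ρ] = ⟪D p, q⟫ := by
    rw [← hρ.covariance_inner]
    conv_rhs => rw [← Measure.snd_prod (μ := μ) (ν := ρ), Measure.snd]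
    rw [covariance_map_fun (by fun_prop) (by fun_prop) (by fun_prop)]
  have h12 : ∀ (a : M) (q : E), cov[fun ω : M × E => ⟪a, ω.1⟫, fun ω => ⟪q, ω.2⟫; μ.prod ρ] = 0 :=
    fun a q => covariance_fst_snd_prod (hX a) (hY q)
  refine (covariance_add_left (hX' a) (hY' p) ((hX' b).add (hY' q))).trans ?_
  rw [covariance_add_right (hX' a) (hX' b) (hY' q),
    covariance_add_right (hY' p) (hX' b) (hY' q), h11, h22, h12,
    covariance_comm (fun ω : M × E => ⟪p, ω.2⟫), h12]
  ring

end Noise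

section Gain

variable {M : Type*} [NormedAddCommGroup M] [InnerProductSpace ℝ M] {d : ℕ}

/-- The data `F m + η`, as a function of the parameter `m` and the noise `η`. -/
noncomputable def dataMap (F : M →L[ℝ] EuclideanSpace ℝ (Fin d)) :
    M × EuclideanSpace ℝ (Fin d) →L[ℝ] EuclideanSpace ℝ (Fin d) :=
  F ∘L ContinuousLinearMap.fst ℝ _ _ + ContinuousLinearMap.snd ℝ _ _

theorem dataMap_apply (F : M →L[ℝ] EuclideanSpace ℝ (Fin d))
    (ω : M × EuclideanSpace ℝ (Fin d)) : dataMap F ω = F ω.1 + ω.2 := rfl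

variable [CompleteSpace M] (F : M →L[ℝ] EuclideanSpace ℝ (Fin d)) (σ : ℝ)

/-- The gain `K = σ⁻² T F*`, where `T` is the posterior covariance operator; the posterior mean is
an affine function of the data with linear part `K`. -/
noncomputable def gain (C : M →L[ℝ] M) : EuclideanSpace ℝ (Fin d) →L[ℝ] M :=
  (σ ^ 2)⁻¹ • (posteriorCov F σ C ∘L F.adjoint)

/-- The estimation error `m - K (F m + η)`, as a function of the parameter `m` and the noise `η`;
it is the part of `m` that is independent of the data. -/
noncomputable def estimationError (C : M →L[ℝ] M) : M × EuclideanSpace ℝ (Fin d) →L[ℝ] M :=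
  ContinuousLinearMap.fst ℝ _ _ - gain F σ C ∘L dataMap F

variable {C : M →L[ℝ] M}

theorem gain_dataMap_add_estimationError (ω : M × EuclideanSpace ℝ (Fin d)) :
    gain F σ C (dataMap F ω) + estimationError F σ C ω = ω.1 := by
  simp [estimationError]

theorem inner_dataMap (p : EuclideanSpace ℝ (Fin d)) (ω : M × EuclideanSpace ℝ (Fin d)) :
    ⟪p, dataMap F ω⟫ = ⟪F.adjoint p, ω.1⟫ + ⟪p, ω.2⟫ := by
  rw [dataMap_apply, inner_add_right, ContinuousLinearMap.adjoint_inner_left]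

theorem inner_gain (hC : ∀ u : M, u ≠ 0 → 0 < ⟪C u, u⟫) (hCs : ∀ u v : M, ⟪C u, v⟫ = ⟪u, C v⟫)
    (u : M) (y : EuclideanSpace ℝ (Fin d)) :
    ⟪u, gain F σ C y⟫ = ⟪(σ ^ 2)⁻¹ • F (posteriorCov F σ C u), y⟫ := by
  rw [gain, smul_apply, ContinuousLinearMap.comp_apply, real_inner_smul_right,
    ← inner_posteriorCov_comm F σ hC hCs, ContinuousLinearMap.adjoint_inner_right,
    real_inner_smul_left]

theorem inner_gain_dataMap (hC : ∀ u : M, u ≠ 0 → 0 < ⟪C u, u⟫)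
    (hCs : ∀ u v : M, ⟪C u, v⟫ = ⟪u, C v⟫) (u : M) (ω : M × EuclideanSpace ℝ (Fin d)) :
    ⟪u, gain F σ C (dataMap F ω)⟫ = ⟪misfitHessian F σ (posteriorCov F σ C u), ω.1⟫ +
      ⟪(σ ^ 2)⁻¹ • F (posteriorCov F σ C u), ω.2⟫ := by
  rw [inner_gain F σ hC hCs, inner_dataMap, map_smul]
  rfl

theorem inner_estimationError (hC : ∀ u : M, u ≠ 0 → 0 < ⟪C u, u⟫)
    (hCs : ∀ u v : M, ⟪C u, v⟫ = ⟪u, C v⟫) (u : M) (ω : M × EuclideanSpace ℝ (Fin d)) :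
    ⟪u, estimationError F σ C ω⟫ = ⟪u - misfitHessian F σ (posteriorCov F σ C u), ω.1⟫ +
      ⟪-((σ ^ 2)⁻¹ • F (posteriorCov F σ C u)), ω.2⟫ := by
  have h := congrArg (fun x => ⟪u, x⟫) (gain_dataMap_add_estimationError F σ (C := C) ω)
  simp only [inner_add_right, inner_gain_dataMap F σ hC hCs] at h
  rw [inner_sub_left, inner_neg_left]
  linarith

end Gain

theorem IsGaussianWith.isGaussian_prod_noise {M : Type*} [NormedAddCommGroup M]
    [InnerProductSpace ℝ M] [MeasurableSpace M] [BorelSpace M] {d : ℕ} {σ : ℝ} {μ : Measure M}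
    {m : M} {C : M →L[ℝ] M} (hμ : IsGaussianWith μ m C) :
    IsGaussian (μ.prod (noise d σ)) := by
  have := hμ.isGaussian
  have := (isGaussianWith_noise d σ).isGaussian
  infer_instance

section DataLaw

variable {M : Type*} [NormedAddCommGroup M] [InnerProductSpace ℝ M]
  [SecondCountableTopology M] [MeasurableSpace M] [BorelSpace M] {d : ℕ}
  (F : M →L[ℝ] EuclideanSpace ℝ (Fin d)) {σ : ℝ} {μ : Measure M} {m : M} {C : M →L[ℝ] M}

theorem compProd_likelihood (hμ : IsGaussianWith μ m C) :
    μ ⊗ₘ likelihood F σ = (μ.prod (noise d σ)).map fun ω => (ω.1, dataMap F ω) := by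
  have := hμ.isGaussian
  have := (isGaussianWith_noise d σ).isGaussian
  exact compProd_eq_map_prod (by fun_prop) fun m => likelihood_apply F σ m

/-- The marginal law of the data. -/
theorem likelihood_comp (hμ : IsGaussianWith μ m C) :
    likelihood F σ ∘ₘ μ = (μ.prod (noise d σ)).map (dataMap F) := by
  have := hμ.isGaussian
  rw [← Measure.snd_compProd, compProd_likelihood F hμ, Measure.snd,
    Measure.map_map measurable_snd (by fun_prop)]
  rfl

end DataLaw

section Posterior

variable {M : Type*} [NormedAddCommGroup M] [InnerProductSpace ℝ M] [CompleteSpace M]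
  [SecondCountableTopology M] [MeasurableSpace M] [BorelSpace M] {d : ℕ}
  (F : M →L[ℝ] EuclideanSpace ℝ (Fin d)) {σ : ℝ} {μ : Measure M} {m : M} {C : M →L[ℝ] M}

theorem IsGaussianWith.integral_prod_noise (hμ : IsGaussianWith μ m C)
    (L : M × EuclideanSpace ℝ (Fin d) →L[ℝ] M) : ∫ ω, L ω ∂(μ.prod (noise d σ)) = L (m, 0) := by
  have := hμ.isGaussian
  have hρ := isGaussianWith_noise d σ
  have := hρ.isGaussian
  have h1 : Integrable (fun ω : M × EuclideanSpace ℝ (Fin d) => ω) (μ.prod (noise d σ)) :=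
    IsGaussian.integrable_fun_id
  have hm : ∫ ω, ω ∂(μ.prod (noise d σ)) = (m, 0) := by
    refine Prod.ext ?_ ?_
    · rw [fst_integral h1, integral_fun_fst (f := fun s => s), hμ.integral_id]
      simp
    · rw [snd_integral h1, integral_fun_snd (f := fun s => s), hρ.integral_id]
      simp
  rw [L.integral_comp_comm h1, hm]

/-- The estimation error has the posterior covariance operator as its covariance operator. -/
theorem isGaussianWith_estimationError (hσ : 0 < σ) (hμ : IsGaussianWith μ m C)
    (hC : ∀ u : M, u ≠ 0 → 0 < ⟪C u, u⟫) :
    IsGaussianWith ((μ.prod (noise d σ)).map (estimationError F σ C)) (m - gain F σ C (F m))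
      (posteriorCov F σ C) := by
  have := hμ.isGaussian_prod_noise (d := d) (σ := σ)
  have hCs := hμ.inner_comm
  refine isGaussianWith_of_covariance ?_ fun u v => ?_
  · rw [integral_map (by fun_prop) (by fun_prop), hμ.integral_prod_noise]
    simp [estimationError, dataMap_apply]
  · rw [covariance_map_fun (by fun_prop) (by fun_prop) (by fun_prop)]
    simp_rw [inner_estimationError F σ hC hCs]
    rw [covariance_prod hμ (isGaussianWith_noise d σ),
      apply_sub_misfitHessian_posteriorCov F σ hC hCs, inner_sub_right,
      ← inner_misfitHessian_comm F σ]
    have hσ2 : σ ^ 2 ≠ 0 := by positivity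
    simp only [misfitHessian, smul_apply, ContinuousLinearMap.comp_apply,
      ContinuousLinearMap.id_apply, smul_neg, smul_inv_smul₀ hσ2, inner_neg_left, inner_neg_right,
      neg_neg, real_inner_smul_left, real_inner_smul_right, ContinuousLinearMap.adjoint_inner_left,
      inner_posteriorCov_comm F σ hC hCs]
    ring

/-- The part `K (F m + η)` of the parameter that is predicted by the data carries the covariance
which the posterior covariance operator lacks. -/
theorem isGaussianWith_gain_dataMap (hσ : 0 < σ) (hμ : IsGaussianWith μ m C)
    (hC : ∀ u : M, u ≠ 0 → 0 < ⟪C u, u⟫) :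
    IsGaussianWith (((μ.prod (noise d σ)).map (dataMap F)).map (gain F σ C)) (gain F σ C (F m))
      (C - posteriorCov F σ C) := by
  have := hμ.isGaussian_prod_noise (d := d) (σ := σ)
  have hCs := hμ.inner_comm
  refine isGaussianWith_of_covariance ?_ fun u v => ?_
  · rw [integral_map (by fun_prop) (by fun_prop), integral_map (by fun_prop) (by fun_prop)]
    exact (hμ.integral_prod_noise (gain F σ C ∘L dataMap F)).trans (by simp [dataMap_apply])
  · rw [covariance_map_fun (by fun_prop) (by fun_prop) (by fun_prop),
      covariance_map_fun (by fun_prop) (by fun_prop) (by fun_prop)]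
    simp_rw [inner_gain_dataMap F σ hC hCs]
    rw [covariance_prod hμ (isGaussianWith_noise d σ)]
    have hσ2 : σ ^ 2 ≠ 0 := by positivity
    have h1 := apply_sub_misfitHessian_posteriorCov F σ hC hCs u
    have h2 := apply_sub_misfitHessian_posteriorCov F σ hC hCs v
    rw [map_sub, sub_eq_iff_eq_add'] at h1 h2
    have h3 : ⟪(σ ^ 2 • ContinuousLinearMap.id ℝ _ : _ →L[ℝ] EuclideanSpace ℝ (Fin d))
        ((σ ^ 2)⁻¹ • F (posteriorCov F σ C u)), (σ ^ 2)⁻¹ • F (posteriorCov F σ C v)⟫ =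
        ⟪posteriorCov F σ C u, misfitHessian F σ (posteriorCov F σ C v)⟫ := by
      simp only [misfitHessian, smul_apply, ContinuousLinearMap.comp_apply,
        ContinuousLinearMap.id_apply, smul_inv_smul₀ hσ2, real_inner_smul_right,
        ContinuousLinearMap.adjoint_inner_right]
    rw [h3, ← inner_add_left, ← h1, hCs, sub_apply, inner_sub_left,
      inner_posteriorCov_comm F σ hC hCs, hCs, h2, inner_add_right]
    ring

/-- The estimation error and the data are jointly Gaussian and uncorrelated, hence independent. -/
theorem indepFun_dataMap_estimationError (hσ : 0 < σ) (hμ : IsGaussianWith μ m C)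
    (hC : ∀ u : M, u ≠ 0 → 0 < ⟪C u, u⟫) :
    IndepFun (dataMap F) (estimationError F σ C) (μ.prod (noise d σ)) := by
  have := hμ.isGaussian_prod_noise (d := d) (σ := σ)
  have hCs := hμ.inner_comm
  have hG : HasGaussianLaw (fun ω => (dataMap F ω, estimationError F σ C ω))
      (μ.prod (noise d σ)) :=
    (IsGaussian.hasGaussianLaw_id (μ := μ.prod (noise d σ))).map
      ((dataMap F).prod (estimationError F σ C))
  refine hG.indepFun_of_covariance_inner fun p u => ?_
  simp_rw [inner_estimationError F σ hC hCs, inner_dataMap]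
  rw [covariance_prod hμ (isGaussianWith_noise d σ), hCs,
    apply_sub_misfitHessian_posteriorCov F σ hC hCs, ContinuousLinearMap.adjoint_inner_left]
  have hσ2 : σ ^ 2 ≠ 0 := by positivity
  simp only [smul_apply, ContinuousLinearMap.id_apply, inner_neg_right,
    real_inner_smul_left, real_inner_smul_right]
  field_simp
  ring

/-- The posterior is `N(K y + const, T)`, with the posterior covariance operator `T`: given the
data `y`, the parameter is `K y` plus the estimation error, which is independent of `y`. -/
theorem ae_isGaussianWith_posterior [IsFiniteMeasure μ] (hσ : 0 < σ) (hμ : IsGaussianWith μ m C)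
    (hC : ∀ u : M, u ≠ 0 → 0 < ⟪C u, u⟫) :
    ∀ᵐ y ∂(likelihood F σ ∘ₘ μ), IsGaussianWith (posterior (likelihood F σ) μ y)
      (gain F σ C y + (m - gain F σ C (F m))) (posteriorCov F σ C) := by
  have := hμ.isGaussian_prod_noise (d := d) (σ := σ)
  set P := μ.prod (noise d σ) with hP
  set ν := P.map (estimationError F σ C) with hν
  have hνG : IsGaussianWith ν _ _ := isGaussianWith_estimationError F hσ hμ hC
  have := hνG.isGaussian
  let κ : Kernel (EuclideanSpace ℝ (Fin d)) M :=
    (Kernel.id ×ₖ Kernel.const _ ν).map fun p => gain F σ C p.1 + p.2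
  have hm : Measurable fun p : EuclideanSpace ℝ (Fin d) × M => gain F σ C p.1 + p.2 := by fun_prop
  have hκ : ∀ y, κ y = ν.map fun s => gain F σ C y + s := fun y => by
    rw [Kernel.map_apply _ hm, Kernel.prod_apply, Kernel.id_apply, Kernel.const_apply,
      Measure.dirac_prod, Measure.map_map hm (by fun_prop)]
    rfl
  have : IsMarkovKernel κ := Kernel.IsMarkovKernel.map _ hm
  have hκμ : (likelihood F σ ∘ₘ μ) ⊗ₘ κ = (μ ⊗ₘ likelihood F σ).map Prod.swap := by
    have hind := (indepFun_iff_map_prod_eq_prod_map_map (by fun_prop) (by fun_prop)).1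
      (indepFun_dataMap_estimationError F hσ hμ hC)
    rw [likelihood_comp F hμ, compProd_likelihood F hμ, compProd_eq_map_prod hm hκ, hν, hP,
      ← hind, Measure.map_map (by fun_prop) (by fun_prop),
      Measure.map_map (by fun_prop) (by fun_prop)]
    congr 1
    funext ω
    simp only [Function.comp_apply, Prod.swap_prod_mk, gain_dataMap_add_estimationError]
  filter_upwards [ae_eq_posterior_of_compProd_eq hκμ] with y hy
  rw [← hy, hκ]
  exact hνG.map_const_add _

end Posterior

/-! ### The goal functional and its expected posterior variance -/

section GoalFunctional

variable {M : Type*} [NormedAddCommGroup M] [InnerProductSpace ℝ M] [CompleteSpace M]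

theorem inner_goalHessian_comm {Z : M → ℝ} {mbar : M}
    (hZ : ∀ᶠ m in 𝓝 mbar, DifferentiableAt ℝ Z m) (hZ' : DifferentiableAt ℝ (∇ Z) mbar) (u v : M) :
    ⟪goalHessian Z mbar u, v⟫ = ⟪u, goalHessian Z mbar v⟫ := by
  let J : M →L[ℝ] M →L[ℝ] ℝ := (isBoundedBilinearMap_inner (𝕜 := ℝ)).toContinuousLinearMap
  have h1 : fderiv ℝ Z = fun m => J (∇ Z m) := by
    funext m
    ext w
    exact (inner_gradient_left).symm
  have h2 : HasFDerivAt (fderiv ℝ Z) (J ∘L goalHessian Z mbar) mbar := by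
    rw [h1]
    exact J.hasFDerivAt.comp mbar hZ'.hasFDerivAt
  have h3 := second_derivative_symmetric_of_eventually
    (hZ.mono fun m hm => hm.hasFDerivAt) h2 u v
  rw [real_inner_comm _ u]
  exact h3

end GoalFunctional

theorem theorem2 {M : Type*} [NormedAddCommGroup M] [InnerProductSpace ℝ M] [CompleteSpace M]
    [SecondCountableTopology M] [MeasurableSpace M] [BorelSpace M] {d : ℕ}
    (F : M →L[ℝ] EuclideanSpace ℝ (Fin d)) (σ : ℝ) (hσ : 0 < σ)
    (μpr : Measure M) [IsFiniteMeasure μpr] (mpr : M) (Cpr : M →L[ℝ] M)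
    (hpr : IsGaussianWith μpr mpr Cpr)
    (hCpr : ∀ u : M, u ≠ 0 → 0 < ⟪Cpr u, u⟫)
    (Z : M → ℝ) (mbar : M)
    (hZ : ∀ᶠ m in 𝓝 mbar, DifferentiableAt ℝ Z m)
    (hZ' : DifferentiableAt ℝ (∇ Z) mbar) :
    -- the variances and expectations in the definition of the criterion are those of
    -- square integrable, respectively integrable, functions
    (∀ᵐ m ∂μpr, ∀ᵐ y ∂(likelihood F σ m),
      MemLp (quadApprox Z mbar) 2 (posterior (likelihood F σ) μpr y)) ∧
    (∀ᵐ m ∂μpr, Integrable (posteriorVariance μpr F σ Z mbar) (likelihood F σ m)) ∧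
    Integrable (fun m => ∫ y, posteriorVariance μpr F σ Z mbar y ∂(likelihood F σ m)) μpr ∧
    -- the operators under the traces are trace class
    IsTraceClass (Cpr ∘L goalHessian Z mbar ∘L posteriorCov F σ Cpr ∘L goalHessian Z mbar) ∧
    IsTraceClass (posteriorCov F σ Cpr ∘L goalHessian Z mbar ∘L
      posteriorCov F σ Cpr ∘L goalHessian Z mbar) ∧
    -- the closed form of the criterion
    goalCriterion μpr F σ Z mbar =
      ⟪posteriorCov F σ Cpr (goalHessian Z mbar (mpr - mbar) + ∇ Z mbar),
        goalHessian Z mbar (mpr - mbar) + ∇ Z mbar⟫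
      + operatorTrace
          (Cpr ∘L goalHessian Z mbar ∘L posteriorCov F σ Cpr ∘L goalHessian Z mbar)
      - 1 / 2 * operatorTrace (posteriorCov F σ Cpr ∘L goalHessian Z mbar ∘L
          posteriorCov F σ Cpr ∘L goalHessian Z mbar) := by
  have := hpr.isGaussian
  have hH := inner_goalHessian_comm hZ hZ'
  set H := goalHessian Z mbar
  set T := posteriorCov F σ Cpr
  set K := gain F σ Cpr
  set g := ∇ Z mbar
  have hTs : ∀ u v, ⟪T u, v⟫ = ⟪u, T v⟫ := inner_posteriorCov_comm F σ hCpr hpr.inner_comm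
  have hCtr : IsTraceClass Cpr := hpr.isTraceClass
  have hTtr : IsTraceClass T := (isGaussianWith_estimationError F hσ hpr hCpr).isTraceClass
  have hW : IsGaussianWith ((likelihood F σ ∘ₘ μpr).map K) (K (F mpr)) (Cpr - T) := by
    rw [likelihood_comp F hpr]
    exact isGaussianWith_gain_dataMap F hσ hpr hCpr
  have hpost := ae_isGaussianWith_posterior F hσ hpr hCpr
  -- the posterior mean is `K y + (mpr - K (F mpr))`; its constant part is moved to `z`
  set z := mbar - (mpr - K (F mpr)) with hz
  set τ := 1 / 2 * operatorTrace (T ∘L H ∘L T ∘L H) with hτ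
  have hvar : posteriorVariance μpr F σ Z mbar =ᵐ[likelihood F σ ∘ₘ μpr]
      fun y => ⟪T (g + H (K y - z)), g + H (K y - z)⟫ + τ := by
    filter_upwards [hpost] with y hy
    have hmean : K y - z = K y + (mpr - K (F mpr)) - mbar := by rw [hz]; abel
    rw [hmean]
    exact (hy.variance_quadratic hH (Z mbar) g mbar).2
  have hmem : ∀ᵐ y ∂(likelihood F σ ∘ₘ μpr),
      MemLp (quadApprox Z mbar) 2 (posterior (likelihood F σ) μpr y) := by
    filter_upwards [hpost] with y hy
    exact (hy.variance_quadratic hH (Z mbar) g mbar).1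
  have hWint : Integrable (fun y => ⟪T (g + H (K y - z)), g + H (K y - z)⟫)
      (likelihood F σ ∘ₘ μpr) := by
    have h1 := (hW.integrable_inner_affine T H (g - H z)).comp_measurable (by fun_prop)
    refine h1.congr (ae_of_all _ fun y => ?_)
    have h2 : g - H z + H (K y) = g + H (K y - z) := by rw [map_sub H (K y) z]; abel
    simp only [Function.comp_apply, h2]
  have hint : Integrable (posteriorVariance μpr F σ Z mbar) (likelihood F σ ∘ₘ μpr) :=
    (hWint.add (integrable_const τ)).congr hvar.symm
  have hmeanW : K (F mpr) - z = mpr - mbar := by rw [hz]; abel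
  have hIW : ∫ y, ⟪T (g + H (K y - z)), g + H (K y - z)⟫ ∂(likelihood F σ ∘ₘ μpr) =
      ⟪T (g + H (mpr - mbar)), g + H (mpr - mbar)⟫ +
        operatorTrace ((Cpr - T) ∘L H ∘L T ∘L H) := by
    rw [← hmeanW, ← hW.integral_inner_affine hTs hH, integral_map (by fun_prop) (by fun_prop)]
  have htr : operatorTrace (Cpr ∘L H ∘L T ∘L H) =
      operatorTrace ((Cpr - T) ∘L H ∘L T ∘L H) + operatorTrace (T ∘L H ∘L T ∘L H) :=
    operatorTrace_add (hW.isTraceClass.comp_right _) (hTtr.comp_right _) (hCtr.comp_right _)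
      fun x => by simp
  refine ⟨Measure.ae_ae_of_ae_comp hmem, Measure.ae_integrable_of_integrable_comp hint, ?_,
    hCtr.comp_right _, hTtr.comp_right _, ?_⟩
  · exact (Measure.integrable_integral_norm_of_integrable_comp hint).congr <| ae_of_all _ fun m =>
      integral_congr_ae <| ae_of_all _ fun y => Real.norm_of_nonneg (variance_nonneg _ _)
  · have hcomp : goalCriterion μpr F σ Z mbar =
        ∫ y, posteriorVariance μpr F σ Z mbar y ∂(likelihood F σ ∘ₘ μpr) := by
      rw [Measure.comp_eq_comp_const_apply] at hint ⊢
      rw [Kernel.integral_comp hint, Kernel.const_apply, goalCriterion]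
    rw [hcomp, integral_congr_ae hvar,
      integral_add hWint (integrable_const τ), hIW, htr, integral_const, add_comm g]
    simp only [probReal_univ, one_smul, hτ]
    ring
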